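/- Let $k$ be an algebraically closed field and let $n, d, e \ge 1$ be integers. Let $N = \binom{n+d}{d}-1$ and let $\mathbb{P}^N$ be the projective space of degree $d$ hypersurfaces in $\mathbb{P}^n$ over $k$ (nonzero forms of degree $d$ in $x_0,\dots,x_n$ up to scalar). A degree $e$ rational curve in $\mathbb{P}^n$ is understood to be a morphism $\varphi=[\varphi_0:\dots:\varphi_n]:\mathbb{P}^1\to\mathbb{P}^n$ given by binary forms $\varphi_i$ of degree $e$ without common zero (multiple covers are allowed), and a hypersurface $V(f)$ is singular along it if $f$ and all its first partial derivatives vanish at every point of $\varphi(\mathbb{P}^1)$. Let $Z \subset \mathbb{P}^N$ be the set of degree $d$ hypersurfaces in $\mathbb{P}^n$ that are singular along some degree $e$ rational curve. Then $Z$ has codimension at least $$n(d-e-1)-e+4$$ in $\mathbb{P}^N$, that is, either $Z$ is empty or its Zariski closure satisfies $\dim \overline{Z} \le N - \bigl(n(d-e-1)-e+4\bigr)$. -/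

import Mathlib

open MvPolynomial
open scoped LinearAlgebra.Projectivization

namespace SingularHypersurface

section ZariskiTopology

variable {k : Type*} [Field k] {ι : Type*}

/-- The common zeros in projective space of a set of polynomials in the homogeneous coordinates.
It is only used for homogeneous polynomials, whose vanishing does not depend on the representative
(see `eval_rep_mk_eq_zero_iff`). -/
def zeroLocus (S : Set (MvPolynomial ι k)) : Set (ℙ k (ι → k)) :=
  {p | ∀ F ∈ S, eval p.rep F = 0}

/-- The Zariski closed subsets of projective space: the common zero loci of sets of homogeneous
polynomials (of possibly different degrees). -/
def IsAlgebraicSet (Z : Set (ℙ k (ι → k))) : Prop :=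
  ∃ S : Set (MvPolynomial ι k), (∀ F ∈ S, ∃ m : ℕ, F.IsHomogeneous m) ∧ Z = zeroLocus S

theorem eval_smul_of_isHomogeneous {F : MvPolynomial ι k} {m : ℕ} (hF : F.IsHomogeneous m)
    (c : k) (v : ι → k) : eval (c • v) F = c ^ m * eval v F := by
  rw [eval_eq, eval_eq, Finset.mul_sum]
  refine Finset.sum_congr rfl fun s hs => ?_
  have hdeg : ∑ i ∈ s.support, s i = m := by
    have := hF (mem_support_iff.mp hs)
    rw [Finsupp.weight_apply] at this
    simpa [Finsupp.sum] using this
  simp only [Pi.smul_apply, smul_eq_mul, mul_pow, Finset.prod_mul_distrib,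
    Finset.prod_pow_eq_pow_sum, hdeg]
  ring

theorem eval_rep_mk_eq_zero_iff {F : MvPolynomial ι k} {m : ℕ} (hF : F.IsHomogeneous m)
    (v : ι → k) (hv : v ≠ 0) :
    eval (Projectivization.mk k v hv).rep F = 0 ↔ eval v F = 0 := by
  obtain ⟨a, ha⟩ := Projectivization.exists_smul_eq_mk_rep k v hv
  rw [← ha, Units.smul_def, eval_smul_of_isHomogeneous hF]
  simp

theorem isAlgebraicSet_empty : IsAlgebraicSet (∅ : Set (ℙ k (ι → k))) := by
  refine ⟨{1}, ?_, ?_⟩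
  · rintro F rfl
    exact ⟨0, isHomogeneous_one ι k⟩
  · ext p
    simp [zeroLocus]

theorem isAlgebraicSet_sInter (A : Set (Set (ℙ k (ι → k)))) (hA : A ⊆ {Z | IsAlgebraicSet Z}) :
    IsAlgebraicSet (⋂₀ A) := by
  have hA' : ∀ Z ∈ A, ∃ S : Set (MvPolynomial ι k),
      (∀ F ∈ S, ∃ m : ℕ, F.IsHomogeneous m) ∧ Z = zeroLocus S := fun Z hZ => hA hZ
  choose! S hS hZ using hA'
  refine ⟨⋃ Z ∈ A, S Z, ?_, ?_⟩
  · intro F hF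
    simp only [Set.mem_iUnion] at hF
    obtain ⟨Z, hZA, hF⟩ := hF
    exact hS Z hZA F hF
  · ext p
    simp only [Set.mem_sInter, zeroLocus, Set.mem_iUnion, Set.mem_ofPred_eq]
    constructor
    · rintro h F ⟨Z, hZA, hF⟩
      have := h Z hZA
      rw [hZ Z hZA] at this
      exact this F hF
    · intro h Z hZA
      rw [hZ Z hZA]
      exact fun F hF => h F ⟨Z, hZA, hF⟩

theorem isAlgebraicSet_union (A B : Set (ℙ k (ι → k))) (hA : IsAlgebraicSet A)
    (hB : IsAlgebraicSet B) : IsAlgebraicSet (A ∪ B) := by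
  obtain ⟨S, hS, rfl⟩ := hA
  obtain ⟨T, hT, rfl⟩ := hB
  refine ⟨{H | ∃ F ∈ S, ∃ G ∈ T, H = F * G}, ?_, ?_⟩
  · rintro H ⟨F, hF, G, hG, rfl⟩
    obtain ⟨a, ha⟩ := hS F hF
    obtain ⟨b, hb⟩ := hT G hG
    exact ⟨a + b, ha.mul hb⟩
  · ext p
    simp only [zeroLocus, Set.mem_union, Set.mem_ofPred_eq]
    constructor
    · rintro (h | h) H ⟨F, hF, G, hG, rfl⟩
      · simp [h F hF]
      · simp [h G hG]
    · intro h
      by_contra! hc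
      obtain ⟨⟨F, hF, hF0⟩, G, hG, hG0⟩ := hc
      have := h _ ⟨F, hF, G, hG, rfl⟩
      simp [hF0, hG0] at this

/-- The Zariski topology on the projective space with homogeneous coordinates indexed by `ι`. -/
instance zariskiTopology : TopologicalSpace (ℙ k (ι → k)) :=
  TopologicalSpace.ofClosed {Z | IsAlgebraicSet Z} isAlgebraicSet_empty isAlgebraicSet_sInter
    fun A hA B hB => isAlgebraicSet_union A B hA hB

theorem isClosed_iff_isAlgebraicSet (Z : Set (ℙ k (ι → k))) : IsClosed Z ↔ IsAlgebraicSet Z := by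
  rw [← isOpen_compl_iff]
  change IsAlgebraicSet Zᶜᶜ ↔ _
  rw [compl_compl]

/-- A subset `Z` of the projective space `ℙ k (ι → k)`, which has dimension `#ι - 1`, has
codimension at least `c`: the dimension of its Zariski closure is at most `#ι - 1 - c`.
The empty set, whose dimension is `⊥`, has codimension at least `c` for every `c`. -/
def CodimAtLeast [Fintype ι] (Z : Set (ℙ k (ι → k))) (c : ℤ) : Prop :=
  ∀ m : ℕ, (m : WithBot ℕ∞) ≤ topologicalKrullDim (closure Z) →
    (m : ℤ) + c ≤ (Fintype.card ι : ℤ) - 1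

end ZariskiTopology

section Hypersurfaces

variable (k : Type*) [Field k] (n d e : ℕ)

/-- The exponents of the monomials of degree `d` in the variables `x_0, …, x_n`. -/
abbrev Exponents : Type :=
  ↥(Finset.finsuppAntidiag (Finset.univ : Finset (Fin (n + 1))) d)

/-- There are `(n + d).choose d` monomials, so that hypersurfaces of degree `d` in `ℙⁿ` form a
projective space of dimension `(n + d).choose d - 1`. -/
theorem card_exponents : Fintype.card (Exponents n d) = (n + d).choose d := by
  rw [Fintype.card_coe, Finset.card_finsuppAntidiag_nat_eq_choose]
  simp only [Finset.card_univ, Fintype.card_fin]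
  congr 1
  omega

/-- The projective space `ℙᴺ` of hypersurfaces of degree `d` in `ℙⁿ`; the homogeneous coordinates
of a hypersurface are the coefficients of its equation. -/
abbrev Hypersurface : Type _ := ℙ k (Exponents n d → k)

variable {k n d}

/-- The form of degree `d` in `x_0, …, x_n` with given coefficients. -/
noncomputable def form (a : Exponents n d → k) : MvPolynomial (Fin (n + 1)) k :=
  ∑ m : Exponents n d, monomial m.1 (a m)

/-- An equation of a hypersurface (well defined up to a nonzero scalar). -/
noncomputable def Hypersurface.equation (X : Hypersurface k n d) : MvPolynomial (Fin (n + 1)) k :=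
  form X.rep

/-- The hypersurface `X` contains the point `p` and is singular there: its equation and all first
partial derivatives of its equation vanish at `p`. -/
def Hypersurface.IsSingularAt (X : Hypersurface k n d) (p : ℙ k (Fin (n + 1) → k)) : Prop :=
  eval p.rep X.equation = 0 ∧ ∀ i : Fin (n + 1), eval p.rep (pderiv i X.equation) = 0

variable (k n)

/-- A morphism `ℙ¹ → ℙⁿ` of degree `e` (over an algebraically closed field): it is given by `n + 1`
binary forms of degree `e` without a common zero on `ℙ¹`. -/
structure RationalCurve where
  coord : Fin (n + 1) → MvPolynomial (Fin 2) k
  isHomogeneous : ∀ i, (coord i).IsHomogeneous e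
  no_common_zero : ∀ v : Fin 2 → k, v ≠ 0 → ∃ i, eval v (coord i) ≠ 0

variable {k n e}

/-- The image of the parametrized rational curve `φ`, a subset of `ℙⁿ`. -/
def RationalCurve.image (φ : RationalCurve k n e) : Set (ℙ k (Fin (n + 1) → k)) :=
  {p | ∃ (v : Fin 2 → k) (_ : v ≠ 0) (h : (fun i => eval v (φ.coord i)) ≠ 0),
    p = Projectivization.mk k (fun i => eval v (φ.coord i)) h}

variable (k n d e)

/-- The hypersurfaces of degree `d` in `ℙⁿ` that are singular at every point of some rational curve
of degree `e`. -/
def singularAlongRationalCurve : Set (Hypersurface k n d) :=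
  {X | ∃ φ : RationalCurve k n e, ∀ p ∈ φ.image, X.IsSingularAt p}

end Hypersurfaces

end SingularHypersurface

/-! The bound is a parameter count over curves and forms, and it rests on one estimate: being
singular along a degree `e` curve imposes at least `nd + 1` independent linear conditions on forms
of degree `d`.

Reparametrize the curve so that `φ_0` vanishes at `0` and some `φ_j` vanishes at infinity, and scale
so that `p_j(0) = 1` and some `p_l` has leading coefficient `1` in degree `e`. This fixes four
coefficients of the curve (`exists_normalized_parametrization`). Now `deg p_j < e = deg p_l`, so no
nonzero binary form vanishes at `(p_j, p_l)`. Consequently no nonzero combination of the `nd + 1`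
monomials `x_j^d` and `x_i x_j^a x_l^(d-1-a)`, `i ≠ j`, is singular along the curve
(`eq_zero_of_specialForm_singular`).

Some square block of the linear conditions is therefore invertible on these special monomials, and
Cramer's rule recovers the special coefficients, up to a common factor, from the curve and the other
coefficients. One nonspecial coefficient is nonzero and can be scaled to `1`. Thus finitely many
polynomial maps cover `Z`, each with `(n+1)(e+1) + (N+1) - (nd+6)` parameters
(`exists_mem_parametrizedSet`, `card_chart`).

The closure of the image of such a map has dimension at most the number of parameters. A chain of
irreducible closed subsets gives a chain of homogeneous primes, hence elements algebraically
independent modulo the smallest prime, and the transcendence degree of a polynomial ring bounds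
their number. -/

namespace SingularHypersurface

/-! ### Chains of primes and transcendence degree. -/

section AlgebraicIndependence

/-- A strictly increasing chain of `n + 1` prime ideals yields `n` elements that are algebraically
independent modulo the smallest one. -/
theorem exists_algebraicIndependent_mod_of_chain {k A : Type*} [Field k] [CommRing A]
    [Algebra k A] : ∀ (n : ℕ) (P : ℕ → Ideal A), (∀ i ≤ n, (P i).IsPrime) →
      (∀ i < n, P i < P (i + 1)) →
      ∃ h : Fin n → A, ∀ G : MvPolynomial (Fin n) k, aeval h G ∈ P 0 → G = 0 := by
  intro n
  induction n with
  | zero =>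
    intro P hP _
    refine ⟨Fin.elim0, fun G hG => ?_⟩
    obtain ⟨c, rfl⟩ := C_surjective (Fin 0) G
    by_contra hc
    have hc' : c ≠ 0 := fun h => hc (by simp [h])
    rw [algHom_C] at hG
    exact (hP 0 le_rfl).ne_top
      (Ideal.eq_top_of_isUnit_mem _ hG ((IsUnit.mk0 c hc').map (algebraMap k A)))
  | succ n ih =>
    intro P hP hlt
    obtain ⟨h, hh⟩ := ih (fun i => P (i + 1)) (fun i hi => hP (i + 1) (by omega))
      (fun i hi => hlt (i + 1) (by omega))
    obtain ⟨x, hx1, hx0⟩ := SetLike.exists_of_lt (hlt 0 (by omega))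
    refine ⟨Fin.cons x h, fun G hG => ?_⟩
    have key : ∀ H : Polynomial (MvPolynomial (Fin n) k),
        aeval (Fin.cons x h : Fin (n + 1) → A) ((finSuccEquiv k n).symm H)
          = H.eval₂ (aeval h : MvPolynomial (Fin n) k →ₐ[k] A).toRingHom x := by
      intro H
      obtain ⟨G, rfl⟩ := (finSuccEquiv k n).surjective H
      rw [AlgEquiv.symm_apply_apply]
      induction G using MvPolynomial.induction_on with
      | C a => simp [finSuccEquiv_apply]
      | add p q hp hq => simp [hp, hq, Polynomial.eval₂_add]
      | mul_X p i hp =>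
        rw [map_mul, map_mul, Polynomial.eval₂_mul, hp]
        congr 1
        refine Fin.cases ?_ (fun i => ?_) i
        · simp [finSuccEquiv_X_zero]
        · simp [finSuccEquiv_X_succ]
    obtain ⟨H, rfl⟩ := (finSuccEquiv k n).symm.surjective G
    rw [key] at hG
    by_contra hne
    have hH : H ≠ 0 := fun h0 => hne (by simp [h0])
    -- Since `x ∉ P 0`, powers of `X` can be cancelled from the relation. As `x ∈ P 1`, the constant
    -- term of what is left lies in `P 1` and vanishes by induction, so `X` divides once more.
    obtain ⟨H', hH', hdvd⟩ := Polynomial.exists_eq_pow_rootMultiplicity_mul_and_not_dvd H hH 0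
    rw [map_zero, sub_zero] at hH' hdvd
    rw [hH', Polynomial.eval₂_mul, Polynomial.eval₂_pow, Polynomial.eval₂_X] at hG
    have hmem := ((hP 0 (by omega)).mem_or_mem hG).resolve_left
      fun hpow => hx0 ((hP 0 (by omega)).mem_of_pow_mem _ hpow)
    apply hdvd
    rw [Polynomial.X_dvd_iff]
    apply hh
    have hmem1 := (hlt 0 (by omega)).le hmem
    rw [← Polynomial.divX_mul_X_add H', Polynomial.eval₂_add, Polynomial.eval₂_mul,
      Polynomial.eval₂_X, Polynomial.eval₂_C] at hmem1
    exact (Ideal.add_mem_iff_right _ (Ideal.mul_mem_left _ _ hx1)).mp hmem1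

/-- A chain of `n + 1` primes containing the kernel of a homomorphism to the polynomial ring
`k[τ][X]` has `n ≤ #τ + 1`. -/
theorem chain_length_le {k A τ : Type*} [Field k] [CommRing A] [Algebra k A] [Fintype τ]
    (θ : A →ₐ[k] Polynomial (MvPolynomial τ k)) (n : ℕ) (P : ℕ → Ideal A)
    (hP : ∀ i ≤ n, (P i).IsPrime) (hlt : ∀ i < n, P i < P (i + 1))
    (hker : ∀ G, θ G = 0 → G ∈ P 0) : n ≤ Fintype.card τ + 1 := by
  obtain ⟨h, hh⟩ := exists_algebraicIndependent_mod_of_chain (k := k) n P hP hlt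
  let e := (optionEquivLeft k τ).symm
  have hind : AlgebraicIndependent k (fun i => e (θ (h i))) := by
    rw [algebraicIndependent_iff]
    intro G hG
    apply hh
    apply hker
    have : aeval (fun i => e (θ (h i))) G = e (θ (aeval h G)) := by
      have := MvPolynomial.comp_aeval_apply h (e.toAlgHom.comp θ) G
      simpa using this.symm
    rw [this] at hG
    simpa using hG
  have h1 := hind.lift_cardinalMk_le_trdeg
  rw [MvPolynomial.trdeg_of_isDomain] at h1
  simp at h1
  exact_mod_cast h1

end AlgebraicIndependence

/-! ### Homogeneous ideals of projective sets. -/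

section Cones

variable {k : Type*} [Field k] {ι : Type*}

/-- The extra variable records the degree, so a single substitution tests all homogeneous components
at once, over any field. -/
theorem coeff_aeval_C_mul_X {B : Type*} [CommRing B] [Algebra k B] (w : ι → B)
    (G : MvPolynomial ι k) (m : ℕ) :
    (aeval (fun i => Polynomial.C (w i) * Polynomial.X) G : Polynomial B).coeff m =
      aeval w (homogeneousComponent m G) := by
  induction G using MvPolynomial.induction_on' with
  | monomial s a =>
    have h1 : (aeval (fun i => Polynomial.C (w i) * Polynomial.X) (monomial s a) : Polynomial B) =
        Polynomial.C (aeval w (monomial s a)) * Polynomial.X ^ s.degree := by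
      rw [aeval_monomial, aeval_monomial, map_mul, mul_assoc]
      congr 1
      simp [Finsupp.prod, mul_pow, Finset.prod_mul_distrib, Finset.prod_pow_eq_pow_sum,
        Finsupp.degree_apply, map_prod]
    have h2 : monomial s a ∈ homogeneousSubmodule ι k s.degree :=
      isHomogeneous_monomial _ rfl
    rw [h1, homogeneousComponent_of_mem h2, Polynomial.coeff_C_mul, Polynomial.coeff_X_pow]
    split_ifs <;> simp
  | add p q hp hq => simp [hp, hq]

theorem aeval_C_mul_X_eq_zero_iff {B : Type*} [CommRing B] [Algebra k B] (w : ι → B)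
    (G : MvPolynomial ι k) :
    (aeval (fun i => Polynomial.C (w i) * Polynomial.X) G : Polynomial B) = 0 ↔
      ∀ m, aeval w (homogeneousComponent m G) = 0 := by
  rw [Polynomial.ext_iff]
  simp [coeff_aeval_C_mul_X]

/-- The homogeneous ideal of a subset of projective space. -/
noncomputable def coneIdeal (Y : Set (ℙ k (ι → k))) : Ideal (MvPolynomial ι k) :=
  ⨅ p ∈ Y, RingHom.ker
    (aeval (fun i => Polynomial.C (p.rep i) * Polynomial.X) : _ →ₐ[k] Polynomial k)

/-- The points at which all homogeneous components of `G` vanish. -/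
def componentLocus (G : MvPolynomial ι k) : Set (ℙ k (ι → k)) :=
  zeroLocus (Set.range fun m => homogeneousComponent m G)

theorem isClosed_componentLocus (G : MvPolynomial ι k) : IsClosed (componentLocus G) := by
  rw [isClosed_iff_isAlgebraicSet]
  refine ⟨_, ?_, rfl⟩
  rintro _ ⟨m, rfl⟩
  exact ⟨m, homogeneousComponent_isHomogeneous m G⟩

theorem mem_componentLocus {G : MvPolynomial ι k} {p : ℙ k (ι → k)} :
    p ∈ componentLocus G ↔
      (aeval (fun i => Polynomial.C (p.rep i) * Polynomial.X) G : Polynomial k) = 0 := by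
  rw [aeval_C_mul_X_eq_zero_iff]
  simp [componentLocus, zeroLocus, aeval_eq_eval]

theorem mem_coneIdeal {Y : Set (ℙ k (ι → k))} {G : MvPolynomial ι k} :
    G ∈ coneIdeal Y ↔ Y ⊆ componentLocus G := by
  simp [coneIdeal, Set.subset_def, mem_componentLocus]

theorem isPrime_coneIdeal {Y : Set (ℙ k (ι → k))} (hY : IsIrreducible Y) :
    (coneIdeal Y).IsPrime := by
  refine ⟨?_, fun {F G} hFG => ?_⟩
  · obtain ⟨p, hp⟩ := hY.nonempty
    rw [Ideal.ne_top_iff_one, mem_coneIdeal]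
    intro h
    simpa using mem_componentLocus.mp (h hp)
  · rw [mem_coneIdeal] at hFG
    simp only [mem_coneIdeal]
    refine isPreirreducible_iff_isClosed_union_isClosed.mp hY.isPreirreducible _ _
      (isClosed_componentLocus F) (isClosed_componentLocus G) fun p hp => ?_
    have := mem_componentLocus.mp (hFG hp)
    rw [map_mul, mul_eq_zero] at this
    exact this.imp mem_componentLocus.mpr mem_componentLocus.mpr

/-- Strictness: the homogeneous equations cutting out `Y` lie in its ideal; if the ideals agreed,
these equations would vanish on `Y'` as well. -/
theorem coneIdeal_lt_coneIdeal {Y Y' : Set (ℙ k (ι → k))} (hY : IsClosed Y) (hlt : Y < Y') :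
    coneIdeal Y' < coneIdeal Y := by
  refine lt_of_le_of_ne (fun G hG => ?_) fun heq => ?_
  · rw [mem_coneIdeal] at hG ⊢
    exact hlt.le.trans hG
  · obtain ⟨S, hS, hYS⟩ := (isClosed_iff_isAlgebraicSet Y).mp hY
    apply hlt.not_ge
    intro p hp
    rw [hYS]
    intro F hF
    obtain ⟨m, hm⟩ := hS F hF
    have hFY : F ∈ coneIdeal Y := by
      rw [mem_coneIdeal]
      intro q hq
      rw [hYS] at hq
      rintro _ ⟨i, rfl⟩
      dsimp only
      rw [homogeneousComponent_of_mem ((mem_homogeneousSubmodule _ _).mpr hm)]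
      split_ifs
      · exact hq F hF
      · simp
    rw [← heq, mem_coneIdeal] at hFY
    have := hFY hp _ ⟨m, rfl⟩
    dsimp only at this
    rwa [homogeneousComponent_of_mem ((mem_homogeneousSubmodule _ _).mpr hm), if_pos rfl] at this

/-- The irrelevant ideal lengthens every chain by one, which offsets the extra cone variable in
`chain_length_le`. -/
theorem coneIdeal_lt_ker_constantCoeff {Y : Set (ℙ k (ι → k))} (hY : Y.Nonempty) :
    coneIdeal Y < RingHom.ker (constantCoeff : MvPolynomial ι k →+* k) := by
  obtain ⟨p, hp⟩ := hY
  refine lt_of_le_of_ne (fun G hG => ?_) fun heq => ?_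
  · have := (mem_coneIdeal.mp hG) hp _ ⟨0, rfl⟩
    simpa [homogeneousComponent_zero, constantCoeff_eq] using this
  · apply p.rep_nonzero
    ext i
    have hX : (X i : MvPolynomial ι k) ∈ coneIdeal Y := by
      rw [heq]
      simp
    have := mem_componentLocus.mp (mem_coneIdeal.mp hX hp)
    simpa using this

end Cones

/-! ### Dimension of images of polynomial maps. -/

section Dimension

variable {k : Type*} [Field k] {ι : Type*}

/-- The points of projective space with homogeneous coordinates `F t`. -/
def parametrizedSet {τ : Type*} (F : ι → MvPolynomial τ k) : Set (ℙ k (ι → k)) :=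
  {p | ∃ (t : τ → k) (h : (fun i => eval t (F i)) ≠ 0),
    p = Projectivization.mk k (fun i => eval t (F i)) h}

theorem closure_parametrizedSet_subset {τ : Type*} (F : ι → MvPolynomial τ k)
    (G : MvPolynomial ι k)
    (hG : (aeval (fun i => Polynomial.C (F i) * Polynomial.X) G :
      Polynomial (MvPolynomial τ k)) = 0) :
    closure (parametrizedSet F) ⊆ componentLocus G := by
  refine closure_minimal ?_ (isClosed_componentLocus G)
  rintro _ ⟨t, h, rfl⟩ _ ⟨m, rfl⟩
  dsimp only
  rw [eval_rep_mk_eq_zero_iff (homogeneousComponent_isHomogeneous m G)]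
  have := congrArg (eval t) ((aeval_C_mul_X_eq_zero_iff F G).mp hG m)
  rw [map_zero] at this
  rw [← this, aeval_def, algebraMap_eq, ← coe_eval₂Hom]
  conv_lhs => rw [← eval₂_id, ← coe_eval₂Hom]
  rw [← RingHom.comp_apply (eval t)]
  congr 1
  ext i <;> simp

/-- A subset of projective space that is covered by the images of finitely many rational maps from
affine spaces of dimension at most `#ι - 1 - c` has codimension at least `c`. -/
theorem codimAtLeast_of_subset_iUnion_parametrizedSet [Fintype ι] {J : Type*} [Finite J]
    {τ : J → Type*} [∀ j, Fintype (τ j)] (F : ∀ j, ι → MvPolynomial (τ j) k)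
    (Z : Set (ℙ k (ι → k))) (hZ : Z ⊆ ⋃ j, parametrizedSet (F j)) (c : ℤ)
    (hc : ∀ j, (Fintype.card (τ j) : ℤ) + c ≤ (Fintype.card ι : ℤ) - 1) :
    CodimAtLeast Z c := by
  intro m hm
  rw [topologicalKrullDim, Order.le_krullDim_iff] at hm
  obtain ⟨l, hl⟩ := hm
  have hemb : Topology.IsClosedEmbedding (Subtype.val : closure Z → ℙ k (ι → k)) :=
    isClosed_closure.isClosedEmbedding_subtypeVal
  let Y : Fin (l.length + 1) → Set (ℙ k (ι → k)) := fun i => Subtype.val '' (l i : Set (closure Z))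
  have hYirr : ∀ i, IsIrreducible (Y i) := fun i =>
    (l i).isIrreducible.image _ continuous_subtype_val.continuousOn
  have hYcl : ∀ i, IsClosed (Y i) := fun i => hemb.isClosedMap _ (l i).isClosed
  have hYlt : ∀ i j, i < j → Y i < Y j := fun i j hij => by
    have : (l i : Set (closure Z)) < l j := l.strictMono hij
    exact Subtype.val_injective.image_strictMono this
  have htop : ∃ j, Y (Fin.last _) ⊆ closure (parametrizedSet (F j)) := by
    have hsub : Y (Fin.last _) ⊆ ⋃ j, closure (parametrizedSet (F j)) := by
      rw [← closure_iUnion_of_finite]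
      refine Set.Subset.trans ?_ (closure_mono hZ)
      rintro _ ⟨p, _, rfl⟩
      exact p.2
    have := isIrreducible_iff_sUnion_isClosed.mp (hYirr (Fin.last _))
      (Set.finite_range fun j => closure (parametrizedSet (F j))).toFinset
      (by simp) (by simpa [Set.sUnion_range] using hsub)
    simpa using this
  obtain ⟨j, hj⟩ := htop
  -- Passing to ideals reverses the chain; the index `l.length + 1` holds the irrelevant ideal.
  let P : ℕ → Ideal (MvPolynomial ι k) := fun i =>
    if h : i ≤ l.length then coneIdeal (Y ⟨l.length - i, by omega⟩)
    else RingHom.ker (constantCoeff : MvPolynomial ι k →+* k)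
  have hlen := chain_length_le (k := k) (aeval (fun i => Polynomial.C (F j i) * Polynomial.X))
    (l.length + 1) P
    (fun i hi => by
      dsimp only [P]
      split_ifs
      · exact isPrime_coneIdeal (hYirr _)
      · exact RingHom.ker_isPrime _)
    (fun i hi => by
      dsimp only [P]
      rw [dif_pos (by omega)]
      split_ifs with h
      · exact coneIdeal_lt_coneIdeal (hYcl _) (hYlt _ _ (by simp [Fin.lt_def]; omega))
      · exact coneIdeal_lt_ker_constantCoeff (hYirr _).nonempty)
    (fun G hG => by
      dsimp only [P]
      rw [dif_pos (by omega), mem_coneIdeal]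
      exact hj.trans (closure_parametrizedSet_subset (F j) G hG))
  have := hc j
  omega

end Dimension

/-! ### Binary forms restricted to an affine line. -/

section BinaryForms

variable {k : Type*} [Field k] {e : ℕ}

theorem eval_aeval_add_mul_X (v w : Fin 2 → k) (G : MvPolynomial (Fin 2) k) (z : k) :
    (aeval (fun i => Polynomial.C (v i) + Polynomial.C (w i) * Polynomial.X) G :
      Polynomial k).eval z = eval (v + z • w) G := by
  induction G using MvPolynomial.induction_on with
  | C a => simp
  | add p q hp hq => simp [hp, hq]
  | mul_X p i hp =>
    rw [map_mul, Polynomial.eval_mul, hp, aeval_X, map_mul, eval_X]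
    simp only [Polynomial.eval_add, Polynomial.eval_C, Polynomial.eval_mul, Polynomial.eval_X,
      Pi.add_apply, Pi.smul_apply, smul_eq_mul]
    ring

theorem coeff_zero_aeval_add_mul_X (v w : Fin 2 → k) (G : MvPolynomial (Fin 2) k) :
    (aeval (fun i => Polynomial.C (v i) + Polynomial.C (w i) * Polynomial.X) G :
      Polynomial k).coeff 0 = eval v G := by
  rw [Polynomial.coeff_zero_eq_eval_zero, eval_aeval_add_mul_X]
  simp

theorem natDegree_aeval_add_mul_X_le (v w : Fin 2 → k) {G : MvPolynomial (Fin 2) k}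
    (hG : G.IsHomogeneous e) :
    (aeval (fun i => Polynomial.C (v i) + Polynomial.C (w i) * Polynomial.X) G :
      Polynomial k).natDegree ≤ e := by
  have := MvPolynomial.aeval_natDegree_le (n := 1) G hG.totalDegree_le
    (fun i => Polynomial.C (v i) + Polynomial.C (w i) * Polynomial.X)
    (fun i => by compute_degree)
  simpa using this

theorem coeff_aeval_add_mul_X (v w : Fin 2 → k) {G : MvPolynomial (Fin 2) k}
    (hG : G.IsHomogeneous e) :
    (aeval (fun i => Polynomial.C (v i) + Polynomial.C (w i) * Polynomial.X) G :
      Polynomial k).coeff e = eval w G := by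
  have hlin : ∀ i, (Polynomial.C (v i) + Polynomial.C (w i) * Polynomial.X).natDegree ≤ 1 :=
    fun i => by compute_degree
  have hpow : ∀ (i : Fin 2) (m : ℕ),
      ((Polynomial.C (v i) + Polynomial.C (w i) * Polynomial.X) ^ m).natDegree ≤ m :=
    fun i m => by simpa using Polynomial.natDegree_pow_le_of_le m (hlin i)
  rw [aeval_def, eval₂_eq', eval_eq', Polynomial.finsetSum_coeff]
  refine Finset.sum_congr rfl fun s hs => ?_
  have hdeg : s 0 + s 1 = e := by
    have := hG (mem_support_iff.mp hs)
    rw [Finsupp.weight_apply, Finsupp.sum_fintype _ _ (by simp)] at this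
    simpa using this
  have hcoeff : ∀ (i : Fin 2) (m : ℕ),
      ((Polynomial.C (v i) + Polynomial.C (w i) * Polynomial.X) ^ m).coeff m = w i ^ m := by
    intro i m
    have := Polynomial.coeff_pow_of_natDegree_le (m := m) (hlin i)
    simpa using this
  rw [Fin.prod_univ_two, Fin.prod_univ_two, Polynomial.algebraMap_eq, Polynomial.coeff_C_mul,
    ← hdeg, Polynomial.coeff_mul_add_eq_of_natDegree_le (hpow _ _) (hpow _ _), hcoeff, hcoeff]

/-- If `(0, 1)` is not a zero, then `G(1, z)` has nonzero coefficient in degree `e ≥ 1`, hence a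
root. -/
theorem exists_zero_of_isHomogeneous [IsAlgClosed k] {G : MvPolynomial (Fin 2) k}
    (hG : G.IsHomogeneous e) (he : 1 ≤ e) : ∃ v : Fin 2 → k, v ≠ 0 ∧ eval v G = 0 := by
  by_cases h : eval ![0, 1] G = 0
  · exact ⟨![0, 1], fun h0 => by simpa using congrFun h0 1, h⟩
  · have hc := coeff_aeval_add_mul_X ![1, 0] ![0, 1] hG
    obtain ⟨z, hz⟩ := IsAlgClosed.exists_root
      (aeval (fun i => Polynomial.C ((![1, 0] : Fin 2 → k) i) +
        Polynomial.C ((![0, 1] : Fin 2 → k) i) * Polynomial.X) G : Polynomial k)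
      (fun hdeg => h <| by
        rw [← hc, Polynomial.coeff_eq_zero_of_degree_lt]
        rw [hdeg]
        exact_mod_cast he)
    rw [Polynomial.IsRoot, eval_aeval_add_mul_X] at hz
    exact ⟨_, fun h0 => by simpa using congrFun h0 0, hz⟩

theorem exists_smul_eval_eq_one [IsAlgClosed k] {G : MvPolynomial (Fin 2) k}
    (hG : G.IsHomogeneous e) (he : 1 ≤ e) {v : Fin 2 → k} (hv : eval v G ≠ 0) :
    ∃ c : k, eval (c • v) G = 1 := by
  obtain ⟨c, hc⟩ := IsAlgClosed.exists_pow_nat_eq (eval v G)⁻¹ (show 0 < e by omega)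
  exact ⟨c, by rw [eval_smul_of_isHomogeneous hG, hc, inv_mul_cancel₀ hv]⟩

end BinaryForms

/-! ### Normalized affine parametrizations. -/

section Curves

variable {k : Type*} [Field k] {n d e : ℕ}

theorem isHomogeneous_sum_monomial {I : Type*} [Fintype I] (u : I → Exponents n d) (b : I → k) :
    (∑ x, monomial (u x).1 (b x)).IsHomogeneous d := by
  refine IsHomogeneous.sum _ _ _ fun x _ => isHomogeneous_monomial _ ?_
  have := (Finset.mem_finsuppAntidiag.mp (u x).2).1
  rwa [Finsupp.degree_eq_sum]

theorem isHomogeneous_form (a : Exponents n d → k) : (form a).IsHomogeneous d :=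
  isHomogeneous_sum_monomial id a

theorem eval_eq_zero_of_isSingularAt {X : Hypersurface k n d} {φ : RationalCurve k n e}
    (hX : ∀ p ∈ φ.image, X.IsSingularAt p) {v : Fin 2 → k} (hv : v ≠ 0) :
    eval (fun i => eval v (φ.coord i)) X.equation = 0 ∧
      ∀ i, eval (fun i => eval v (φ.coord i)) (pderiv i X.equation) = 0 := by
  have hne : (fun i => eval v (φ.coord i)) ≠ 0 := by
    obtain ⟨i, hi⟩ := φ.no_common_zero v hv
    exact fun h => hi (congrFun h i)
  have hsing := hX _ ⟨v, hv, hne, rfl⟩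
  refine ⟨(eval_rep_mk_eq_zero_iff (isHomogeneous_form _) _ hne).mp hsing.1, fun i => ?_⟩
  exact (eval_rep_mk_eq_zero_iff (isHomogeneous_form _).pderiv _ hne).mp (hsing.2 i)

/-- After a change of coordinates on `ℙ¹`, a rational curve has an affine parametrization by
polynomials of degree at most `e` of which four coefficients are prescribed. -/
theorem exists_normalized_parametrization [IsAlgClosed k] (he : 1 ≤ e) {X : Hypersurface k n d}
    (hX : X ∈ singularAlongRationalCurve k n d e) :
    ∃ (j l : Fin (n + 1)) (p : Fin (n + 1) → Polynomial k), j ≠ 0 ∧ l ≠ j ∧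
      (∀ i, (p i).natDegree ≤ e) ∧ (p 0).coeff 0 = 0 ∧ (p j).coeff 0 = 1 ∧
      (p j).coeff e = 0 ∧ (p l).coeff e = 1 ∧ aeval p X.equation = 0 ∧
      ∀ i, aeval p (pderiv i X.equation) = 0 := by
  obtain ⟨φ, hφ⟩ := hX
  have hom := φ.isHomogeneous
  obtain ⟨v, hv, hv0⟩ := exists_zero_of_isHomogeneous (hom 0) he
  obtain ⟨j, hj⟩ := φ.no_common_zero v hv
  obtain ⟨w, hw, hw0⟩ := exists_zero_of_isHomogeneous (hom j) he
  obtain ⟨l, hl⟩ := φ.no_common_zero w hw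
  obtain ⟨a, ha⟩ := exists_smul_eval_eq_one (hom j) he hj
  obtain ⟨b, hb⟩ := exists_smul_eval_eq_one (hom l) he hl
  -- The form `φ_j` vanishes at `w` but not at `v`, so the line misses the origin.
  have hne : ∀ z : k, a • v + z • (b • w) ≠ 0 := by
    intro z hz
    have h1 : a • v = (-(z * b)) • w := by
      rw [neg_smul, mul_smul]
      exact eq_neg_of_add_eq_zero_left hz
    rw [h1, eval_smul_of_isHomogeneous (hom j), hw0, mul_zero] at ha
    exact zero_ne_one ha
  have hzero : ∀ G : MvPolynomial (Fin (n + 1)) k,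
      (∀ u : Fin 2 → k, u ≠ 0 → eval (fun i => eval u (φ.coord i)) G = 0) →
      aeval (fun i => (aeval (fun s => Polynomial.C ((a • v) s) +
        Polynomial.C ((b • w) s) * Polynomial.X) (φ.coord i) : Polynomial k)) G = 0 := by
    intro G hG
    refine Polynomial.funext fun z => ?_
    rw [Polynomial.eval_zero, ← hG _ (hne z), ← Polynomial.coe_evalRingHom, map_aeval,
      ← aeval_eq_eval, aeval_def, coe_eval₂Hom]
    congr 1
    · ext; simp
    · ext i
      rw [Polynomial.coe_evalRingHom, eval_aeval_add_mul_X]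
  refine ⟨j, l, _, ?_, ?_, fun i => natDegree_aeval_add_mul_X_le (a • v) (b • w) (hom i), ?_, ?_,
    ?_, ?_, hzero _ fun u hu => (eval_eq_zero_of_isSingularAt hφ hu).1,
    fun i => hzero _ fun u hu => (eval_eq_zero_of_isSingularAt hφ hu).2 i⟩
  · rintro rfl
    exact hj hv0
  · rintro rfl
    exact hl hw0
  · rw [coeff_zero_aeval_add_mul_X, eval_smul_of_isHomogeneous (hom 0), hv0, mul_zero]
  · rw [coeff_zero_aeval_add_mul_X, ha]
  · rw [coeff_aeval_add_mul_X _ _ (hom j), eval_smul_of_isHomogeneous (hom j), hw0, mul_zero]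
  · rw [coeff_aeval_add_mul_X _ _ (hom l), hb]

end Curves

/-! ### Forms in the special monomials. -/

section SpecialMonomials

variable {k : Type*} [Field k] {n d e : ℕ}

/-- Only the pure power of `q` reaches the top degree, because `deg p < e`. So `b 0 = 0`, and
dividing by `p` lowers `m`. -/
theorem eq_zero_of_sum_mul_pow_mul_pow_eq_zero {p q : Polynomial k} (hp : p ≠ 0)
    (hpe : p.natDegree < e) (hq : q.natDegree ≤ e) (hqe : q.coeff e ≠ 0) :
    ∀ (m : ℕ) (b : ℕ → k),
      ∑ a ∈ Finset.range (m + 1), Polynomial.C (b a) * p ^ a * q ^ (m - a) = 0 →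
      ∀ a ≤ m, b a = 0 := by
  intro m
  induction m with
  | zero =>
    intro b h a ha
    obtain rfl : a = 0 := by omega
    simpa using h
  | succ m ih =>
    intro b h
    rw [Finset.sum_range_succ'] at h
    have hfac : ∑ a ∈ Finset.range (m + 1),
        Polynomial.C (b (a + 1)) * p ^ (a + 1) * q ^ (m + 1 - (a + 1)) =
        p * ∑ a ∈ Finset.range (m + 1), Polynomial.C (b (a + 1)) * p ^ a * q ^ (m - a) := by
      rw [Finset.mul_sum]
      refine Finset.sum_congr rfl fun a _ => ?_
      rw [Nat.add_sub_add_right]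
      ring
    rw [hfac] at h
    have hdeg : (∑ a ∈ Finset.range (m + 1),
        Polynomial.C (b (a + 1)) * p ^ a * q ^ (m - a)).natDegree ≤ m * e := by
      refine Polynomial.natDegree_sum_le_of_forall_le _ _ fun a ha => ?_
      have ha' : a ≤ m := by simpa [Nat.lt_succ_iff] using ha
      refine Polynomial.natDegree_mul_le.trans ?_
      have h1 := Polynomial.natDegree_C_mul_le (b (a + 1)) (p ^ a)
      have h2 := Polynomial.natDegree_pow_le_of_le a hpe.le
      have h3 := Polynomial.natDegree_pow_le_of_le (m - a) hq
      have h4 : a * e + (m - a) * e = m * e := by rw [← add_mul]; congr 1; omega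
      omega
    have hb0 : b 0 = 0 := by
      have hc := congrArg (Polynomial.coeff · (e * (m + 1))) h
      simp only [Polynomial.coeff_add, pow_zero, mul_one, Nat.sub_zero, Polynomial.coeff_C_mul,
        Polynomial.coeff_zero] at hc
      rw [Polynomial.coeff_eq_zero_of_natDegree_lt, zero_add, mul_comm e,
        Polynomial.coeff_pow_of_natDegree_le hq] at hc
      · exact (mul_eq_zero.mp hc).resolve_right (pow_ne_zero _ hqe)
      · refine Polynomial.natDegree_mul_le.trans_lt ?_
        nlinarith
    rw [hb0] at h
    have hrest := (mul_eq_zero.mp (by simpa using h)).resolve_left hp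
    intro a ha
    cases a with
    | zero => exact hb0
    | succ a => exact ih (fun a => b (a + 1)) hrest a (by omega)

/-- Indices for the monomials `x_j ^ d` and `x_i * x_j ^ a * x_l ^ (d - 1 - a)`, `i ≠ j`. -/
abbrev SpecialIndex (d : ℕ) (j : Fin (n + 1)) : Type :=
  Option ({i : Fin (n + 1) // i ≠ j} × Fin d)

/-- The monomials `x_j ^ d` and `x_i * x_j ^ a * x_l ^ (d - 1 - a)`, `i ≠ j`. -/
noncomputable def specialExponent (d : ℕ) (j l : Fin (n + 1)) :
    SpecialIndex d j → Exponents n d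
  | none => ⟨Finsupp.single j d, by
      simp [Finset.mem_finsuppAntidiag]⟩
  | some (i, a) => ⟨Finsupp.single i.1 1 + Finsupp.single j a.1 + Finsupp.single l (d - 1 - a.1), by
      have := a.2
      rw [Finset.mem_finsuppAntidiag]
      refine ⟨?_, Finset.subset_univ _⟩
      simp only [Finsupp.coe_add, Pi.add_apply, Finset.sum_add_distrib, Finsupp.single_apply,
        Finset.sum_ite_eq, Finset.mem_univ, if_true]
      omega⟩

theorem card_specialIndex (d : ℕ) (j : Fin (n + 1)) :
    Fintype.card (SpecialIndex d j) = n * d + 1 := by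
  simp [Fintype.card_subtype_compl]

theorem specialExponent_injective {j l : Fin (n + 1)} (hlj : l ≠ j) :
    Function.Injective (specialExponent d j l) := by
  have hj : ∀ (i : {i : Fin (n + 1) // i ≠ j}) (a : Fin d),
      (specialExponent d j l (some (i, a))).1 j = a.1 := by
    intro i a
    simp [specialExponent, i.2, hlj]
  have hnone : (specialExponent d j l none).1 j = d := by simp [specialExponent]
  rintro (_ | ⟨i, a⟩) (_ | ⟨i', a'⟩) h
  · rfl
  · have := congrArg (fun m : Exponents n d => m.1 j) h
    simp only [hj, hnone] at this
    omega
  · have := congrArg (fun m : Exponents n d => m.1 j) h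
    simp only [hj, hnone] at this
    omega
  · have ha := congrArg (fun m : Exponents n d => m.1 j) h
    simp only [hj] at ha
    obtain rfl : a = a' := Fin.ext ha
    have h1 : (Finsupp.single i.1 1 : Fin (n + 1) →₀ ℕ) = Finsupp.single i'.1 1 := by
      have := congrArg Subtype.val h
      simpa [specialExponent] using this
    have h2 : i.1 = i'.1 := by
      simpa using (Finsupp.single_left_inj one_ne_zero).mp h1
    rw [Subtype.ext h2]

/-- The form with coefficients `b` at the special monomials. -/
noncomputable def specialForm (j l : Fin (n + 1)) (b : SpecialIndex d j → k) :
    MvPolynomial (Fin (n + 1)) k :=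
  ∑ x, monomial (specialExponent d j l x).1 (b x)

theorem specialForm_eq (j l : Fin (n + 1)) (b : SpecialIndex d j → k) :
    specialForm j l b = C (b none) * X j ^ d +
      ∑ i : {i : Fin (n + 1) // i ≠ j}, X i.1 *
        ∑ a : Fin d, C (b (some (i, a))) * X j ^ a.1 * X l ^ (d - 1 - a.1) := by
  rw [specialForm, Fintype.sum_option, Fintype.sum_prod_type]
  congr 1
  · simp [specialExponent, C_mul_X_pow_eq_monomial]
  · refine Finset.sum_congr rfl fun i _ => ?_
    rw [Finset.mul_sum]
    refine Finset.sum_congr rfl fun a _ => ?_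
    simp only [X_pow_eq_monomial, C_mul_monomial, monomial_mul]
    simp only [X, monomial_mul, specialExponent, one_mul, mul_one, add_assoc]

theorem pderiv_specialForm (j l : Fin (n + 1)) (b : SpecialIndex d j → k)
    (i : {i : Fin (n + 1) // i ≠ j}) (hil : i.1 ≠ l) :
    pderiv i.1 (specialForm j l b) =
      ∑ a : Fin d, C (b (some (i, a))) * X j ^ a.1 * X l ^ (d - 1 - a.1) := by
  have hj : pderiv i.1 (X j : MvPolynomial (Fin (n + 1)) k) = 0 := pderiv_X_of_ne i.2.symm
  have hl : pderiv i.1 (X l : MvPolynomial (Fin (n + 1)) k) = 0 := pderiv_X_of_ne hil.symm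
  have hB : ∀ i' : {i : Fin (n + 1) // i ≠ j}, pderiv i.1
      (∑ a : Fin d, C (b (some (i', a))) * X j ^ a.1 * X l ^ (d - 1 - a.1)) = 0 := by
    intro i'
    rw [map_sum]
    refine Finset.sum_eq_zero fun a _ => ?_
    simp [Derivation.leibniz, Derivation.leibniz_pow, hj, hl]
  rw [specialForm_eq, map_add, map_sum, Finset.sum_eq_single i]
  · rw [Derivation.leibniz _ (X i.1), hB, pderiv_X_self]
    simp [Derivation.leibniz, Derivation.leibniz_pow, hj]
  · intro i' _ hi'
    rw [Derivation.leibniz _ (X i'.1), hB, pderiv_X_of_ne fun h => hi' (Subtype.ext h)]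
    simp
  · simp

/-- A form that involves only the special monomials is not singular along a curve
parametrized by `p` with `deg p_j < deg p_l`. -/
theorem eq_zero_of_specialForm_singular (hd : 1 ≤ d) {j l : Fin (n + 1)} (hlj : l ≠ j)
    {p : Fin (n + 1) → Polynomial k} (hp0 : p j ≠ 0) (hpj : (p j).natDegree < e)
    (hpl : (p l).natDegree ≤ e) (hple : (p l).coeff e ≠ 0) (b : SpecialIndex d j → k)
    (hf : aeval p (specialForm j l b) = 0)
    (hdf : ∀ i, aeval p (pderiv i (specialForm j l b)) = 0) : b = 0 := by
  -- For `i ≠ j, l` the form is linear in `x_i`, so its derivative is a binary form of degree `d -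
  -- 1` in `x_j, x_l`, in any characteristic.
  have hsome : ∀ i : {i : Fin (n + 1) // i ≠ j}, i.1 ≠ l → ∀ a, b (some (i, a)) = 0 := by
    intro i hil a
    have h := hdf i.1
    rw [pderiv_specialForm j l b i hil] at h
    have := eq_zero_of_sum_mul_pow_mul_pow_eq_zero hp0 hpj hpl hple (d - 1)
      (fun a => if ha : a < d then b (some (i, ⟨a, ha⟩)) else 0) (by
        rw [← h, map_sum, Nat.sub_add_cancel hd, Finset.sum_range]
        refine Finset.sum_congr rfl fun a _ => ?_
        simp) a.1 (by have := a.2; omega)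
    simpa using this
  -- What remains is itself a binary form of degree `d` in `x_j, x_l`, with `x_j^d` as the term `a =
  -- d`; no derivative is needed.
  have hl : ∀ a ≤ d, (if ha : a < d then b (some (⟨l, hlj⟩, ⟨a, ha⟩)) else b none) = 0 := by
    refine eq_zero_of_sum_mul_pow_mul_pow_eq_zero hp0 hpj hpl hple d
      (fun a => if ha : a < d then b (some (⟨l, hlj⟩, ⟨a, ha⟩)) else b none) ?_
    rw [← hf, specialForm_eq, Finset.sum_eq_single (⟨l, hlj⟩ : {i : Fin (n + 1) // i ≠ j}),
      Finset.sum_range_succ, Finset.sum_range, map_add, add_comm]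
    · congr 1
      · simp
      · rw [map_mul, map_sum, Finset.mul_sum]
        refine Finset.sum_congr rfl fun a _ => ?_
        have : d - a.1 = d - 1 - a.1 + 1 := by have := a.2; omega
        simp only [Fin.is_lt, dite_true, this, pow_succ]
        simp
        ring
    · intro i _ hi
      simp [hsome i fun h => hi (Subtype.ext h)]
    · simp
  funext x
  obtain _ | ⟨i, a⟩ := x
  · simpa using hl d le_rfl
  · by_cases hil : i.1 = l
    · subst hil
      simpa using hl a.1 a.2.le
    · exact hsome i hil a

end SpecialMonomials

/-- Full column rank makes the rows span, so a basis can be chosen among them. -/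
theorem exists_rows_det_ne_zero {K ρ I : Type*} [Field K] [Fintype ρ] [Fintype I] [DecidableEq I]
    (A : Matrix ρ I K) (hA : ∀ b, A.mulVec b = 0 → b = 0) :
    ∃ r : I → ρ, (A.submatrix r id).det ≠ 0 := by
  have hinj : Function.Injective A.mulVecLin :=
    (injective_iff_map_eq_zero _).mpr fun b hb => hA b (by simpa using hb)
  have hspan : Submodule.span K (Set.range A.row) = ⊤ := by
    apply Submodule.eq_top_of_finrank_eq
    rw [← Matrix.rank_eq_finrank_span_row, Matrix.rank, LinearMap.finrank_range_of_inj hinj]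
  obtain ⟨κ', a, -, ha, hli⟩ := exists_linearIndependent' K A.row
  let B := Module.Basis.mk hli (by rw [ha, hspan])
  let E := B.indexEquiv (Pi.basisFun K I)
  refine ⟨a ∘ E.symm, ?_⟩
  rw [← isUnit_iff_ne_zero, ← Matrix.isUnit_iff_isUnit_det,
    ← Matrix.linearIndependent_rows_iff_isUnit]
  exact hli.comp E.symm E.symm.injective

/-! ### The linear conditions for being singular along a curve. -/

section SingularMatrix

variable {k : Type*} [Field k] {n d e : ℕ}

/-- The identity for `none` and the partial derivative with respect to `x_i` for `some i`. -/
noncomputable def idOrPderiv : Option (Fin (n + 1)) →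
    MvPolynomial (Fin (n + 1)) k →ₗ[k] MvPolynomial (Fin (n + 1)) k
  | none => LinearMap.id
  | some i => (pderiv i).toLinearMap

theorem totalDegree_idOrPderiv_le (o : Option (Fin (n + 1))) {F : MvPolynomial (Fin (n + 1)) k}
    (hF : F.IsHomogeneous d) : (idOrPderiv o F).totalDegree ≤ d := by
  cases o with
  | none => exact hF.totalDegree_le
  | some i => exact (hF.pderiv (i := i)).totalDegree_le.trans (Nat.sub_le d 1)

variable {R : Type*} [CommRing R] [Algebra k R]

/-- Indices for the conditions on a form of degree `d` to be singular along a polynomial curve of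
degree `e`. -/
abbrev ConditionIndex (n d e : ℕ) : Type := Option (Fin (n + 1)) × Fin (d * e + 1)

/-- The matrix of the linear conditions on a form of degree `d` to be singular along the curve
parametrized by `q`. -/
noncomputable def singularMatrix (k : Type*) [Field k] {R : Type*} [CommRing R] [Algebra k R]
    (n d e : ℕ) (q : Fin (n + 1) → Polynomial R) :
    Matrix (ConditionIndex n d e) (Exponents n d) R :=
  fun s c => (aeval q (idOrPderiv s.1 (monomial c.1 (1 : k)))).coeff s.2

theorem map_singularMatrix {R' : Type*} [CommRing R'] [Algebra k R'] (f : R →ₐ[k] R')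
    (q : Fin (n + 1) → Polynomial R) :
    (singularMatrix k n d e q).map f =
      singularMatrix k n d e fun i => (q i).map (f : R →+* R') := by
  ext s c
  have h := MvPolynomial.comp_aeval_apply q (Polynomial.mapAlgHom f)
    (idOrPderiv s.1 (monomial c.1 (1 : k)))
  have h' := congrArg (Polynomial.coeff · s.2) h
  simpa [singularMatrix] using h'

theorem singularMatrix_submatrix_mulVec {I : Type*} [Fintype I] (u : I → Exponents n d)
    (p : Fin (n + 1) → Polynomial k) (b : I → k) (s : ConditionIndex n d e) :
    ((singularMatrix k n d e p).submatrix id u).mulVec b s =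
      (aeval p (idOrPderiv s.1 (∑ x, monomial (u x).1 (b x)))).coeff s.2 := by
  rw [map_sum, map_sum, Polynomial.finsetSum_coeff, Matrix.mulVec, dotProduct]
  refine Finset.sum_congr rfl fun x _ => ?_
  have : monomial (u x).1 (b x) = b x • (monomial (u x).1 (1 : k)) := by
    rw [smul_monomial, smul_eq_mul, mul_one]
  rw [this, map_smul, map_smul, Polynomial.coeff_smul, smul_eq_mul, mul_comm]
  rfl

theorem singularMatrix_submatrix_mulVec_eq_zero_iff {I : Type*} [Fintype I]
    (u : I → Exponents n d) {p : Fin (n + 1) → Polynomial k} (hp : ∀ i, (p i).natDegree ≤ e)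
    (b : I → k) :
    ((singularMatrix k n d e p).submatrix id u).mulVec b = 0 ↔
      ∀ o, aeval p (idOrPderiv o (∑ x, monomial (u x).1 (b x))) = 0 := by
  constructor
  · intro h o
    ext m
    by_cases hm : m < d * e + 1
    · have := congrFun h (o, ⟨m, hm⟩)
      rwa [singularMatrix_submatrix_mulVec] at this
    -- Coefficients beyond degree `d * e` vanish automatically, so the finitely many rows suffice.
    · refine Polynomial.coeff_eq_zero_of_natDegree_lt (lt_of_le_of_lt ?_ (not_lt.mp hm))
      exact MvPolynomial.aeval_natDegree_le _
        (totalDegree_idOrPderiv_le o (isHomogeneous_sum_monomial u b)) _ hp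
  · intro h
    funext s
    rw [singularMatrix_submatrix_mulVec, h]
    simp

end SingularMatrix

/-! ### Solving for the special coefficients. -/

section Cramer

variable {k : Type*} [Field k] {n d e : ℕ} {R : Type*} [CommRing R] [Algebra k R]

/-- Indices for the coefficients of a parametrized curve of degree `e` and a form of degree `d`. -/
abbrev IncidenceIndex (n d e : ℕ) : Type := (Fin (n + 1) × Fin (e + 1)) ⊕ Exponents n d

/-- The polynomial curve with given coefficients. -/
noncomputable def polynomialCurve (x : Fin (n + 1) × Fin (e + 1) → R) (i : Fin (n + 1)) :
    Polynomial R :=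
  ∑ m : Fin (e + 1), Polynomial.C (x (i, m)) * Polynomial.X ^ (m : ℕ)

/-- Cramer's rule: the solution of the equations with indices `r`, up to a factor, in terms of the
coefficients at the non-special monomials. -/
noncomputable def cramerForm (k : Type*) [Field k] {R : Type*} [CommRing R] [Algebra k R]
    {n d e : ℕ} (j l : Fin (n + 1)) (r : SpecialIndex d j → ConditionIndex n d e)
    (x : IncidenceIndex n d e → R) (c : Exponents n d) : R :=
  ((singularMatrix k n d e (polynomialCurve (x ∘ Sum.inl))).submatrix r
      (specialExponent d j l)).det * x (Sum.inr c) -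
    ∑ y, if specialExponent d j l y = c then
      (((singularMatrix k n d e (polynomialCurve (x ∘ Sum.inl))).submatrix r
        (specialExponent d j l)).adjugate.mulVec
          (((singularMatrix k n d e (polynomialCurve (x ∘ Sum.inl))).submatrix r id).mulVec
            (x ∘ Sum.inr))) y
    else 0

/-- Naturality lets the formula at the generic point specialize to actual curves and forms. -/
theorem map_cramerForm {R' : Type*} [CommRing R'] [Algebra k R'] (f : R →ₐ[k] R')
    (j l : Fin (n + 1)) (r : SpecialIndex d j → ConditionIndex n d e)
    (x : IncidenceIndex n d e → R) (c : Exponents n d) :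
    f (cramerForm k j l r x c) = cramerForm k j l r (f ∘ x) c := by
  have hM : (singularMatrix k n d e (polynomialCurve ((f ∘ x) ∘ Sum.inl))) =
      (singularMatrix k n d e (polynomialCurve (x ∘ Sum.inl))).map f := by
    rw [map_singularMatrix]
    congr 1
    funext i
    simp [polynomialCurve, Polynomial.map_sum]
  rw [cramerForm, cramerForm, hM, map_sub, map_mul, map_sum, AlgHom.map_det]
  congr 1
  refine Finset.sum_congr rfl fun y _ => ?_
  split_ifs
  · have h1 := RingHom.map_mulVec (f : R →+* R')
      ((singularMatrix k n d e (polynomialCurve (x ∘ Sum.inl))).submatrix r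
        (specialExponent d j l)).adjugate
      (((singularMatrix k n d e (polynomialCurve (x ∘ Sum.inl))).submatrix r id).mulVec
            (x ∘ Sum.inr)) y
    have h2 : ((f : R →+* R') ∘ (((singularMatrix k n d e
        (polynomialCurve (x ∘ Sum.inl))).submatrix r id).mulVec (x ∘ Sum.inr))) =
        (((singularMatrix k n d e (polynomialCurve (x ∘ Sum.inl))).map f).submatrix r id).mulVec
          ((f ∘ x) ∘ Sum.inr) := by
      funext z
      exact RingHom.map_mulVec (f : R →+* R') _ _ z
    rw [h2] at h1
    refine h1.trans ?_
    congr 2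
    exact RingHom.map_adjugate (f : R →+* R') _
  · exact map_zero f

/-- The equations indexed by `r` read `A b = -M x`, with `b` the special part of `a`. Multiplying by
the adjugate of `A` gives `det A • b`. -/
theorem cramerForm_eq_smul {j l : Fin (n + 1)} (hlj : l ≠ j)
    (r : SpecialIndex d j → ConditionIndex n d e) (x : IncidenceIndex n d e → R)
    (hx : ∀ y, x (Sum.inr (specialExponent d j l y)) = 0) (a : Exponents n d → R)
    (ha : ∀ c ∉ Set.range (specialExponent d j l), x (Sum.inr c) = a c)
    (hsing : (singularMatrix k n d e (polynomialCurve (x ∘ Sum.inl))).mulVec a = 0) :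
    cramerForm k j l r x =
      ((singularMatrix k n d e (polynomialCurve (x ∘ Sum.inl))).submatrix r
        (specialExponent d j l)).det • a := by
  have hinj := specialExponent_injective (d := d) hlj
  set M := singularMatrix k n d e (polynomialCurve (x ∘ Sum.inl))
  set A := M.submatrix r (specialExponent d j l)
  have hsplit : ∀ s, M.mulVec a s = (M.submatrix id (specialExponent d j l)).mulVec
      (a ∘ specialExponent d j l) s + M.mulVec (x ∘ Sum.inr) s := by
    intro s
    simp only [Matrix.mulVec, dotProduct, Matrix.submatrix_apply, id, Function.comp]
    have h1 : ∑ y, M s (specialExponent d j l y) * a (specialExponent d j l y) =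
        ∑ c, M s c * (a c - x (Sum.inr c)) := by
      refine Fintype.sum_of_injective _ hinj _ _ (fun c hc => ?_) fun y => ?_
      · rw [ha c hc, sub_self, mul_zero]
      · rw [hx, sub_zero]
    rw [h1, ← Finset.sum_add_distrib]
    refine Finset.sum_congr rfl fun c _ => ?_
    ring
  have hrow : (M.submatrix r id).mulVec (x ∘ Sum.inr) =
      -(A.mulVec (a ∘ specialExponent d j l)) := by
    funext y
    have h1 := hsplit (r y)
    rw [hsing] at h1
    exact eq_neg_of_add_eq_zero_right h1.symm
  funext c
  rw [cramerForm, hrow, Matrix.mulVec_neg, Matrix.mulVec_mulVec, Matrix.adjugate_mul,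
    Matrix.smul_mulVec, Matrix.one_mulVec]
  by_cases hc : c ∈ Set.range (specialExponent d j l)
  · obtain ⟨y, rfl⟩ := hc
    simp [hx, hinj.eq_iff]
    rfl
  · rw [ha c hc, Finset.sum_eq_zero]
    · simp
      rfl
    · intro y _
      rw [if_neg fun h => hc ⟨y, h⟩]

end Cramer

/-! ### Finitely many charts covering the singular locus. -/

section Charts

variable {k : Type*} [Field k] {κ : Type*}

/-- The generic point of the affine subspace where the coordinates in `S` are those of `v`. -/
noncomputable def genericPoint [DecidableEq κ] (S : Finset κ) (v : κ → k) (c : κ) :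
    MvPolynomial {c // c ∉ S} k :=
  if h : c ∉ S then X ⟨c, h⟩ else C (v c)

theorem aeval_genericPoint [DecidableEq κ] (S : Finset κ) (v t : κ → k)
    (ht : ∀ c ∈ S, t c = v c) :
    (aeval (fun c : {c // c ∉ S} => t c) : _ →ₐ[k] k) ∘ genericPoint S v = t := by
  funext c
  by_cases h : c ∈ S
  · simp [genericPoint, h, ht]
  · simp [genericPoint, h]

variable {n d e : ℕ}

/-- The coefficients that are fixed in a chart: four coefficients of the curve, the special
coefficients of the form and the coefficient at `c₀`. -/
noncomputable def fixedIndices (e : ℕ) (j l : Fin (n + 1)) (c₀ : Exponents n d) :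
    Finset (IncidenceIndex n d e) :=
  Finset.disjSum {(0, 0), (j, 0), (j, Fin.last e), (l, Fin.last e)}
    (insert c₀ (Finset.univ.image (specialExponent d j l)))

/-- The values of the coefficients with indices in `fixedIndices`. -/
noncomputable def fixedValues (k : Type*) [Field k] (e : ℕ) (j l : Fin (n + 1))
    (c₀ : Exponents n d) (c : IncidenceIndex n d e) : k :=
  if c = Sum.inl (j, 0) ∨ c = Sum.inl (l, Fin.last e) ∨ c = Sum.inr c₀ then 1 else 0

theorem card_fixedIndices (he : 1 ≤ e) {j l : Fin (n + 1)} (hj : j ≠ 0) (hl : l ≠ j)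
    {c₀ : Exponents n d} (hc₀ : c₀ ∉ Set.range (specialExponent d j l)) :
    (fixedIndices e j l c₀).card = n * d + 6 := by
  have he0 : Fin.last e ≠ 0 := by simp [Fin.ext_iff]; omega
  rw [fixedIndices, Finset.card_disjSum,
    Finset.card_insert_of_notMem (a := c₀) (by simpa using hc₀),
    Finset.card_image_of_injective _ (specialExponent_injective hl), Finset.card_univ,
    card_specialIndex, Finset.card_insert_of_notMem, Finset.card_insert_of_notMem,
    Finset.card_insert_of_notMem, Finset.card_singleton]
  · ring
  · simp [hl.symm]
  · simp [he0.symm]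
  · simp [he0.symm, hj.symm]

theorem card_chart (he : 1 ≤ e) {j l : Fin (n + 1)} (hj : j ≠ 0) (hl : l ≠ j)
    {c₀ : Exponents n d} (hc₀ : c₀ ∉ Set.range (specialExponent d j l)) :
    Fintype.card {c // c ∉ fixedIndices e j l c₀} + (n * d + 6) =
      (n + 1) * (e + 1) + Fintype.card (Exponents n d) := by
  have h1 := card_fixedIndices he hj hl hc₀
  have h2 := Finset.card_le_univ (fixedIndices e j l c₀)
  have h3 : Fintype.card (IncidenceIndex n d e) =
      (n + 1) * (e + 1) + Fintype.card (Exponents n d) := by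
    simp [Fintype.card_sum]
  have h4 : Fintype.card {c // c ∉ fixedIndices e j l c₀} =
      Fintype.card (IncidenceIndex n d e) - (fixedIndices e j l c₀).card := by
    rw [Fintype.card_subtype_compl, Fintype.card_coe]
  omega

variable [IsAlgClosed k]

theorem exists_mem_parametrizedSet (hd : 1 ≤ d) (he : 1 ≤ e) {X : Hypersurface k n d}
    (hX : X ∈ singularAlongRationalCurve k n d e) :
    ∃ (j l : Fin (n + 1)) (c₀ : Exponents n d) (r : SpecialIndex d j → ConditionIndex n d e),
      j ≠ 0 ∧ l ≠ j ∧ c₀ ∉ Set.range (specialExponent d j l) ∧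
      X ∈ parametrizedSet (cramerForm k j l r
        (genericPoint (fixedIndices e j l c₀) (fixedValues k e j l c₀))) := by
  obtain ⟨j, l, p, hj, hl, hpe, h00, hj0, hje, hle, hf, hdf⟩ :=
    exists_normalized_parametrization he hX
  have hsing : ∀ o, aeval p (idOrPderiv o (form X.rep)) = 0 := by
    rintro (_ | i)
    · exact hf
    · exact hdf i
  have hpj : (p j).natDegree < e := by
    refine lt_of_le_of_ne (hpe j) fun h => ?_
    rw [← h, Polynomial.coeff_natDegree, Polynomial.leadingCoeff_eq_zero] at hje
    simp [hje] at hj0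
  have hspecial : ∀ b, ((singularMatrix k n d e p).submatrix id
      (specialExponent d j l)).mulVec b = 0 → b = 0 := by
    intro b hb
    rw [singularMatrix_submatrix_mulVec_eq_zero_iff _ hpe] at hb
    exact eq_zero_of_specialForm_singular hd hl (fun h => by simp [h] at hj0) hpj (hpe l)
      (by simp [hle]) b (hb none) fun i => hb (some i)
  obtain ⟨r, hr⟩ := exists_rows_det_ne_zero _ hspecial
  have hMX : (singularMatrix k n d e p).mulVec X.rep = 0 :=
    (singularMatrix_submatrix_mulVec_eq_zero_iff id hpe X.rep).mpr hsing
  -- Otherwise the equation would involve only special monomials and hence be zero.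
  obtain ⟨c₀, hc₀, hXc₀⟩ : ∃ c₀ ∉ Set.range (specialExponent d j l), X.rep c₀ ≠ 0 := by
    by_contra! hcon
    have hb := hspecial (X.rep ∘ specialExponent d j l) (by
      rw [← hMX]
      funext s
      simp only [Matrix.mulVec, dotProduct]
      refine Fintype.sum_of_injective _ (specialExponent_injective hl) _ _ (fun c hc => ?_)
        fun y => rfl
      rw [hcon c hc, mul_zero])
    apply X.rep_nonzero
    funext c
    by_cases hc : c ∈ Set.range (specialExponent d j l)
    · obtain ⟨y, rfl⟩ := hc
      exact congrFun hb y
    · exact hcon c hc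
  refine ⟨j, l, c₀, r, hj, hl, hc₀, ?_⟩
  set a : Exponents n d → k := (X.rep c₀)⁻¹ • X.rep with ha
  -- The special slots are set to `0`, as in `fixedValues`; Cramer's rule restores their true
  -- values.
  let t : IncidenceIndex n d e → k := Sum.elim (fun s => (p s.1).coeff s.2)
    (fun c => if c ∈ Set.range (specialExponent d j l) then 0 else a c)
  have hcurve : polynomialCurve (t ∘ Sum.inl) = p := by
    funext i
    rw [(p i).as_sum_range_C_mul_X_pow' (Nat.lt_succ_of_le (hpe i)), Finset.sum_range]
    rfl
  have ht : ∀ c ∈ fixedIndices e j l c₀, t c = fixedValues k e j l c₀ c := by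
    have he0 : Fin.last e ≠ 0 := by simp [Fin.ext_iff]; omega
    intro c hc
    rw [fixedIndices, Finset.mem_disjSum] at hc
    simp only [Finset.mem_insert, Finset.mem_singleton, Finset.mem_image, Finset.mem_univ,
      true_and] at hc
    obtain ⟨c, rfl | rfl | rfl | rfl, rfl⟩ | ⟨c, rfl | ⟨y, rfl⟩, rfl⟩ := hc
    · simp [t, fixedValues, h00, hj.symm, he0.symm]
    · simp [t, fixedValues, hj0]
    · simp [t, fixedValues, hje, he0, hl.symm]
    · simp [t, fixedValues, hle]
    · simp only [t, fixedValues, Sum.elim_inr, if_neg hc₀]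
      simp [ha, hXc₀]
    · have : specialExponent d j l y ≠ c₀ := fun h => hc₀ ⟨y, h⟩
      simp [t, fixedValues, this]
  have heval : ∀ c, eval (fun c : {c // c ∉ fixedIndices e j l c₀} => t c)
      (cramerForm k j l r (genericPoint (fixedIndices e j l c₀) (fixedValues k e j l c₀)) c) =
      cramerForm k j l r t c := by
    intro c
    rw [← aeval_eq_eval, map_cramerForm, aeval_genericPoint _ _ _ ht]
  have hform : cramerForm k j l r t = (((singularMatrix k n d e p).submatrix r
      (specialExponent d j l)).det * (X.rep c₀)⁻¹) • X.rep := by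
    rw [cramerForm_eq_smul hl r t (fun y => by simp [t]) a (fun c hc => by simp only [t,
      Sum.elim_inr, if_neg hc]) (by rw [hcurve, ha, Matrix.mulVec_smul, hMX, smul_zero]), hcurve,
      ha, smul_smul]
  have hscalar : ((singularMatrix k n d e p).submatrix r
      (specialExponent d j l)).det * (X.rep c₀)⁻¹ ≠ 0 := mul_ne_zero hr (inv_ne_zero hXc₀)
  refine ⟨fun c => t c, ?_, ?_⟩
  · simp only [heval, hform]
    exact smul_ne_zero hscalar X.rep_nonzero
  · simp only [heval, hform]
    conv_lhs => rw [← X.mk_rep]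
    rw [Projectivization.mk_eq_mk_iff']
    exact ⟨(((singularMatrix k n d e p).submatrix r
      (specialExponent d j l)).det * (X.rep c₀)⁻¹)⁻¹, by
        rw [smul_smul, inv_mul_cancel₀ hscalar, one_smul]⟩

end Charts

end SingularHypersurface

theorem mainTheorem9 (k : Type*) [Field k] [IsAlgClosed k] (n d e : ℕ)
    (hn : 1 ≤ n) (hd : 1 ≤ d) (he : 1 ≤ e) :
    SingularHypersurface.CodimAtLeast
      (SingularHypersurface.singularAlongRationalCurve k n d e)
      ((n : ℤ) * ((d : ℤ) - (e : ℤ) - 1) - (e : ℤ) + 4) := by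
  open SingularHypersurface in
  let J := Σ s : {s : Fin (n + 1) × Fin (n + 1) × Exponents n d //
      s.1 ≠ 0 ∧ s.2.1 ≠ s.1 ∧ s.2.2 ∉ Set.range (specialExponent d s.1 s.2.1)},
    (SpecialIndex d s.1.1 → ConditionIndex n d e)
  refine codimAtLeast_of_subset_iUnion_parametrizedSet (J := J)
    (τ := fun s => {c // c ∉ fixedIndices e s.1.1.1 s.1.1.2.1 s.1.1.2.2})
    (fun s => cramerForm k s.1.1.1 s.1.1.2.1 s.2
        (genericPoint (fixedIndices e s.1.1.1 s.1.1.2.1 s.1.1.2.2)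
          (fixedValues k e s.1.1.1 s.1.1.2.1 s.1.1.2.2))) _ ?_ _ ?_
  · intro X hX
    obtain ⟨j, l, c₀, r, hj, hl, hc₀, hmem⟩ := exists_mem_parametrizedSet hd he hX
    exact Set.mem_iUnion.mpr ⟨⟨⟨(j, l, c₀), hj, hl, hc₀⟩, r⟩, hmem⟩
  · rintro ⟨⟨⟨j, l, c₀⟩, hj, hl, hc₀⟩, r⟩
    have := card_chart he hj hl hc₀
    zify at this
    -- The count is sharp: the parameters plus the claimed codimension equal `N` exactly.
    dsimp only
    linarith
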